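/- All graphs are finite, simple, undirected and non-empty, and $\log$ is the natural logarithm. For a graph $G$ and an integer $r\ge 1$, let $f_G(r)$ (the growth of $G$) be the maximum of $|V(H)|$ over all subgraphs $H$ of $G$ with radius at most $r$. A tree-decomposition of $G$ is a family $(B_x)_{x\in V(T)}$ of subsets of $V(G)$ indexed by the nodes of a tree $T$ such that every edge of $G$ has both ends in some $B_x$, and for every vertex $v$ of $G$ the set $\{x\in V(T): v\in B_x\}$ induces a non-empty subtree of $T$; its width is $\max_x|B_x|-1$, and $\mathrm{tw}(G)$ is the minimum width of a tree-decomposition of $G$. **Theorem.** (a) Let $g\colon\mathbb{R}\to\mathbb{R}$ be any function such that for every real $c\ge 1$, every graph $G$ with $f_G(r)\le cr$ for all integers $r\ge 1$ satisfies $\mathrm{tw}(G)\le g(c)$. Then $g(c)\in\Omega(c\log c)$ as $c\to\infty$; that is, there are $\delta>0$ and $c_0$ such that $g(c)\ge\delta\, c\log c$ for all real $c\ge c_0$. (b) There are absolute constants $\alpha,\beta>0$ such that for every integer $k\ge 2$ there is a cubic graph $G$ with $\mathrm{tw}(G)\ge k$, with $\mathrm{tw}(G)\ge\alpha|V(G)|$,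 and with $f_G(r)\le \dfrac{\beta k r}{\log k}$ for every integer $r\ge 1$. -/

import Mathlib

namespace SimpleGraph

/-- The growth `f_G(r)` of a graph `G`: the supremum of the number of vertices of a subgraph of
`G` with radius at most `r`. (A disconnected or empty subgraph has radius `⊤`.) -/
noncomputable def growth {V : Type*} (G : SimpleGraph V) (r : ℕ) : ℕ∞ :=
  ⨆ (H : G.Subgraph) (_ : H.coe.radius ≤ (r : ℕ∞)), H.verts.encard

/-- A tree-decomposition of a graph `G`: bags of vertices of `G`, indexed by the nodes of a
tree. -/
structure TreeDecomposition {V : Type*} (G : SimpleGraph V) where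
  /-- The nodes of the tree. -/
  Node : Type
  /-- The tree. -/
  tree : SimpleGraph Node
  isTree : tree.IsTree
  /-- The bags. -/
  bag : Node → Set V
  edge_mem_bag : ∀ u v : V, G.Adj u v → ∃ x : Node, u ∈ bag x ∧ v ∈ bag x
  /-- The nodes whose bag contains `v` induce a non-empty subtree (`Connected` includes
  non-emptiness). -/
  connected : ∀ v : V, (tree.induce {x : Node | v ∈ bag x}).Connected

/-- The width of a tree-decomposition of a non-empty graph: the size of the largest bag,
minus `1`. -/
noncomputable def TreeDecomposition.width {V : Type*} {G : SimpleGraph V}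
    (D : G.TreeDecomposition) : ℕ∞ :=
  (⨆ x : D.Node, (D.bag x).encard) - 1

/-- The treewidth of a non-empty graph: the least width of a tree-decomposition. -/
noncomputable def treewidth {V : Type*} (G : SimpleGraph V) : ℕ∞ :=
  ⨅ D : G.TreeDecomposition, D.width

end SimpleGraph

/-! Everything rests on cubic graphs with 640k vertices and treewidth at least k. In a cubic graph a
ball of radius r has at most 4^r vertices, so the growth is at most min(4^r, 640k). This is O(kr/log
k): the exponential bound wins for r well below log k, the trivial one beyond that. Taking k of
order c log c makes the growth at most cr, which gives (a).

The graphs join two families of 10k disjoint 32-cycles by a perfect matching. A union bound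
(`Equiv.Perm.exists_mixing`) yields a matching with an edge between any 2k cycles of one family and
any 2k of the other. A tree-decomposition has a bag that is a balanced separator
(`exists_balanced_bag`); a bag of at most k vertices leaves most cycles intact, and the matching
then joins parts that it should separate (`le_treewidth_matchedCycles`). -/

/-! ### Union bound for mixing permutations -/

open Finset in
/-- The permutations that map `A` into the complement of `B` are rare. -/
theorem Equiv.Perm.card_avoiding_mul_le {α : Type*} [Fintype α] [DecidableEq α]
    (A B : Finset α) :
    #{σ : Equiv.Perm α | ∀ a ∈ A, σ a ∉ B} * Fintype.card α ^ #A ≤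
      (Fintype.card α).factorial * (Fintype.card α - #B) ^ #A := by
  induction A using Finset.induction_on with
  | empty => simp [Fintype.card_perm]
  | insert a A ha ih =>
    set S : Finset (Equiv.Perm α) := {σ | ∀ a ∈ A, σ a ∉ B} with hS
    set S' : Finset (Equiv.Perm α) := {σ | ∀ x ∈ insert a A, σ x ∉ B} with hS'
    have hsub : S' ⊆ S := by
      intro σ hσ
      simp only [hS, hS', mem_filter, mem_univ, true_and, mem_insert] at hσ ⊢
      exact fun x hx => hσ x (Or.inr hx)
    -- Switching: swapping the values `σ a` and `b` makes `a` land in `B` and leaves the rest of `A`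
    -- outside it; remembering `σ a` makes the switch reversible.
    have hinj : #(S' ×ˢ B) ≤ #((S \ S') ×ˢ Bᶜ) := by
      refine card_le_card_of_injOn (fun p => (Equiv.swap (p.1 a) p.2 * p.1, p.1 a)) ?_ ?_
      · rintro ⟨σ, b⟩ hp
        simp only [coe_product, Set.mem_prod, mem_coe, hS', mem_filter, mem_univ, true_and,
          mem_insert] at hp
        obtain ⟨hσ, hb⟩ := hp
        have hσa : σ a ∉ B := hσ a (Or.inl rfl)
        simp only [coe_product, Set.mem_prod, mem_coe, hS', hS, mem_sdiff, mem_filter, mem_univ,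
          true_and, mem_insert, mem_compl]
        refine ⟨⟨fun x hx => ?_, fun h => ?_⟩, hσa⟩
        · have hxB := hσ x (Or.inr hx)
          have hxa : σ x ≠ σ a := fun h => ha (σ.injective h ▸ hx)
          have hxb : σ x ≠ b := fun h => hxB (h ▸ hb)
          simpa [Equiv.swap_apply_of_ne_of_ne hxa hxb] using hxB
        · have := h a (Or.inl rfl)
          simp at this
          exact this hb
      · rintro ⟨σ, b⟩ _ ⟨τ, c⟩ _ h
        simp only [Prod.mk.injEq] at h
        obtain ⟨h1, h2⟩ := h
        have hbc : b = c := by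
          have := congrArg (fun f : Equiv.Perm α => f a) h1
          simpa using this
        subst hbc
        rw [h2] at h1
        exact Prod.ext (mul_left_cancel h1) rfl
    rw [card_product, card_product, card_sdiff_of_subset hsub, card_compl] at hinj
    have hBle : #B ≤ Fintype.card α := card_le_univ B
    have hSle : #S' ≤ #S := card_le_card hsub
    have key : #S' * Fintype.card α ≤ #S * (Fintype.card α - #B) := by
      obtain ⟨d, hd⟩ := Nat.exists_eq_add_of_le hBle
      obtain ⟨e, he⟩ := Nat.exists_eq_add_of_le hSle
      rw [he, hd] at hinj ⊢
      simp only [Nat.add_sub_cancel_left] at hinj ⊢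
      nlinarith
    rw [card_insert_of_notMem ha, pow_succ', pow_succ']
    calc #S' * (Fintype.card α * Fintype.card α ^ #A)
        = (#S' * Fintype.card α) * Fintype.card α ^ #A := by ring
      _ ≤ (#S * (Fintype.card α - #B)) * Fintype.card α ^ #A := by gcongr
      _ = (#S * Fintype.card α ^ #A) * (Fintype.card α - #B) := by ring
      _ ≤ ((Fintype.card α).factorial * (Fintype.card α - #B) ^ #A) *
            (Fintype.card α - #B) := by gcongr
      _ = _ := by ring

open Finset in
/-- There is a permutation of `10 t` blocks of size `32` that sends a point of any `2 t` blocks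
into any other `2 t` blocks. -/
theorem Equiv.Perm.exists_mixing (t : ℕ) (ht : 0 < t) :
    ∃ σ : Equiv.Perm (Fin (10 * t) × ZMod 32), ∀ A B : Finset (Fin (10 * t)),
      2 * t ≤ #A → 2 * t ≤ #B → ∃ p, p.1 ∈ A ∧ (σ p).1 ∈ B := by
  set X := Fin (10 * t) × ZMod 32
  have hX : Fintype.card X = 320 * t := by simp [X, ZMod.card]; ring
  set Q : Finset (Finset (Fin (10 * t))) := univ.powersetCard (2 * t)
  set bad : Finset (Fin (10 * t)) × Finset (Fin (10 * t)) → Finset (Equiv.Perm X) := fun AB =>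
    {σ | ∀ p ∈ AB.1 ×ˢ (univ : Finset (ZMod 32)), σ p ∉ AB.2 ×ˢ (univ : Finset (ZMod 32))}
  have hbad : ∀ AB ∈ Q ×ˢ Q, #(bad AB) * 5 ^ (64 * t) ≤
      (320 * t).factorial * 4 ^ (64 * t) := by
    intro AB hAB
    rw [mem_product, mem_powersetCard_univ, mem_powersetCard_univ] at hAB
    have h := Equiv.Perm.card_avoiding_mul_le (AB.1 ×ˢ (univ : Finset (ZMod 32)))
      (AB.2 ×ˢ (univ : Finset (ZMod 32)))
    simp only [card_product, hAB.1, hAB.2, card_univ, ZMod.card] at h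
    rw [hX, show 2 * t * 32 = 64 * t by ring, show 320 * t = 5 * (64 * t) by ring,
      show 5 * (64 * t) - 64 * t = 4 * (64 * t) by omega, mul_pow 5, mul_pow 4] at h
    rw [show 320 * t = 5 * (64 * t) by ring]
    have hpos : 0 < (64 * t) ^ (64 * t) := by positivity
    refine Nat.le_of_mul_le_mul_right ?_ hpos
    calc _ = #(bad AB) * (5 ^ (64 * t) * (64 * t) ^ (64 * t)) := by ring
      _ ≤ (5 * (64 * t)).factorial * (4 ^ (64 * t) * (64 * t) ^ (64 * t)) := h
      _ = _ := by ring
  have hQ : #(Q ×ˢ Q) ≤ 2 ^ (20 * t) := by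
    have h1 : #Q ≤ 2 ^ (10 * t) := by
      have := card_le_univ Q
      simpa using this
    rw [card_product, show 20 * t = 10 * t + 10 * t by ring, pow_add]
    exact Nat.mul_le_mul h1 h1
  have hunion : #((Q ×ˢ Q).biUnion bad) < Fintype.card (Equiv.Perm X) := by
    rw [Fintype.card_perm, hX]
    have h5 : 0 < 5 ^ (64 * t) := by positivity
    refine Nat.lt_of_mul_lt_mul_right (a := 5 ^ (64 * t)) ?_
    calc #((Q ×ˢ Q).biUnion bad) * 5 ^ (64 * t)
        ≤ (∑ AB ∈ Q ×ˢ Q, #(bad AB)) * 5 ^ (64 * t) := by gcongr; exact card_biUnion_le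
      _ = ∑ AB ∈ Q ×ˢ Q, #(bad AB) * 5 ^ (64 * t) := sum_mul ..
      _ ≤ #(Q ×ˢ Q) * ((320 * t).factorial * 4 ^ (64 * t)) := by
        simpa using sum_le_card_nsmul _ _ _ hbad
      _ ≤ 2 ^ (20 * t) * ((320 * t).factorial * 4 ^ (64 * t)) := by gcongr
      _ = (320 * t).factorial * (2 ^ 20 * 4 ^ 64) ^ t := by rw [mul_pow, ← pow_mul, ← pow_mul]; ring
      -- The block size 32 is the least `s` with `2 ^ 20 * 4 ^ (2 * s) < 5 ^ (2 * s)`.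
      _ < (320 * t).factorial * (5 ^ 64) ^ t := by
        have : (2 ^ 20 * 4 ^ 64 : ℕ) ^ t < (5 ^ 64) ^ t :=
          Nat.pow_lt_pow_left (by norm_num) ht.ne'
        exact Nat.mul_lt_mul_of_pos_left this (Nat.factorial_pos _)
      _ = _ := by rw [← pow_mul]
  obtain ⟨σ, -, hσ⟩ := exists_mem_notMem_of_card_lt_card (by simpa using hunion :
    #((Q ×ˢ Q).biUnion bad) < #(univ : Finset (Equiv.Perm X)))
  refine ⟨σ, fun A B hA hB => ?_⟩
  obtain ⟨A', hA', hAc⟩ := exists_subset_card_eq hA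
  obtain ⟨B', hB', hBc⟩ := exists_subset_card_eq hB
  by_contra! hcon
  refine hσ (mem_biUnion.2 ⟨(A', B'), ?_, ?_⟩)
  · simp [Q, hAc, hBc]
  · simp only [bad, mem_filter, mem_univ, true_and, mem_product, and_true]
    exact fun p hp hq => hcon p (hA' hp) (hB' (mem_product.1 hq).1)

/-! ### Medians of trees and balanced separators -/

open Finset in
/-- If every colour class has at most `b` elements, then some union of colour classes has between
`t` and `t + b` elements. -/
theorem Finset.exists_colors_card_between {ι κ : Type*} [DecidableEq κ] (s : Finset ι)
    (c : ι → κ) (b t : ℕ) (hb : ∀ y, #{i ∈ s | c i = y} ≤ b) (ht : t ≤ #s) :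
    ∃ P : Finset κ, t ≤ #{i ∈ s | c i ∈ P} ∧ #{i ∈ s | c i ∈ P} ≤ t + b := by
  -- Add colours one at a time: the colour with which the count first reaches `t` overshoots by at
  -- most `b`.
  have key : ∀ P : Finset κ, t ≤ #{i ∈ s | c i ∈ P} →
      ∃ P : Finset κ, t ≤ #{i ∈ s | c i ∈ P} ∧ #{i ∈ s | c i ∈ P} ≤ t + b := by
    intro P
    induction P using Finset.induction_on with
    | empty => exact fun h => ⟨∅, h, by simp⟩
    | insert a P _ ih =>
      intro h
      by_cases hP : t ≤ #{i ∈ s | c i ∈ P}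
      · exact ih hP
      refine ⟨insert a P, h, ?_⟩
      classical
      have hu : {i ∈ s | c i ∈ insert a P} ⊆
          ({i ∈ s | c i ∈ P} : Finset ι) ∪ ({i ∈ s | c i = a} : Finset ι) := by
        intro i hi
        simp only [mem_filter, mem_insert, mem_union] at hi ⊢
        tauto
      have h1 := (card_le_card hu).trans (card_union_le _ _)
      have h2 := hb a
      omega
  refine key (s.image c) (ht.trans_eq (congrArg card ?_))
  ext i
  simp only [mem_filter, mem_image]
  exact ⟨fun h => ⟨h, i, h, rfl⟩, fun h => h.1⟩

namespace SimpleGraph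

/-- Each such neighbour is the penultimate vertex of a geodesic from `z` to `x`, and a tree has only
one path between them. -/
theorem IsTree.closer_neighbor_unique {N : Type*} {T : SimpleGraph N} (hT : T.IsTree)
    {x y y' z : N} (hy : T.Adj x y) (hy' : T.Adj x y') (hd : T.dist z y + 1 = T.dist z x)
    (hd' : T.dist z y' + 1 = T.dist z x) : y = y' := by
  obtain ⟨p, -, hp⟩ := hT.connected.exists_path_of_dist z y
  obtain ⟨p', -, hp'⟩ := hT.connected.exists_path_of_dist z y'
  have h1 : (p.concat hy.symm).IsPath :=
    Walk.isPath_of_length_eq_dist _ (by rw [Walk.length_concat, hp, hd])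
  have h2 : (p'.concat hy'.symm).IsPath :=
    Walk.isPath_of_length_eq_dist _ (by rw [Walk.length_concat, hp', hd'])
  have h3 := congrArg (fun q : T.Path z x => q.1.penultimate)
    ((hT.isAcyclic.subsingleton_path z x).elim ⟨_, h1⟩ ⟨_, h2⟩)
  simpa using h3

theorem Connected.exists_closer_neighbor {N : Type*} {T : SimpleGraph N} (hT : T.Connected)
    {x z : N} (hne : z ≠ x) : ∃ y, T.Adj x y ∧ T.dist z y + 1 = T.dist z x := by
  obtain ⟨p, -, hp⟩ := hT.exists_path_of_dist x z
  cases p with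
  | nil => exact absurd rfl hne
  | @cons _ y _ h q =>
    refine ⟨y, h, ?_⟩
    rw [Walk.length_cons] at hp
    have h1 := dist_le q
    have h2 := hT.dist_triangle (u := x) (v := y) (w := z)
    have h3 := dist_eq_one_iff_adj.2 h
    rw [dist_comm (u := z) (v := y), dist_comm (u := z) (v := x)]
    omega

open Finset Classical in
/-- Every finite family of nodes of a tree has a median: a node `x` such that each component of
the tree minus `x` contains at most half of the family. The component of a node `a ≠ x` is
recorded by the neighbour `h a` of `x` in it. -/
theorem IsTree.exists_median {N ι : Type*} {T : SimpleGraph N} (hT : T.IsTree)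
    (s : Finset ι) (z : ι → N) :
    ∃ (x : N) (h : N → N), (∀ a b, T.Adj a b → a ≠ x → b ≠ x → h a = h b) ∧
      ∀ y, 2 * #{i ∈ s | z i ≠ x ∧ h (z i) = y} ≤ #s := by
  have := hT.connected.nonempty
  -- The median minimises the total distance: a step to a neighbour `y` gains 1 for each member in
  -- the component of `y` and loses at most 1 for each other member.
  let f : N → ℕ := fun x => ∑ i ∈ s, T.dist (z i) x
  let x := Function.argmin f
  have hx : ∀ y, f x ≤ f y := fun y => Function.argmin_le f y
  have hex : ∀ a, ∃ y, a ≠ x → T.Adj x y ∧ T.dist a y + 1 = T.dist a x := by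
    intro a
    by_cases ha : a = x
    · exact ⟨x, fun h => absurd ha h⟩
    · obtain ⟨y, hy⟩ := hT.connected.exists_closer_neighbor ha
      exact ⟨y, fun _ => hy⟩
  choose h hh using hex
  have hstep : ∀ a b, T.Adj a b → a ≠ x → b ≠ x → T.dist x b = T.dist x a + 1 → h a = h b := by
    intro a b hab ha hb hd
    obtain ⟨ha1, ha2⟩ := hh a ha
    obtain ⟨hb1, hb2⟩ := hh b hb
    refine hT.closer_neighbor_unique ha1 hb1 ?_ hb2
    have h1 := hT.connected.dist_triangle (u := b) (v := a) (w := h a)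
    have h2 := hT.connected.dist_triangle (u := b) (v := h a) (w := x)
    have h3 := dist_eq_one_iff_adj.2 hab.symm
    have h4 := dist_eq_one_iff_adj.2 ha1.symm
    have h5 := dist_comm (G := T) (u := x) (v := b)
    have h6 := dist_comm (G := T) (u := x) (v := a)
    omega
  refine ⟨x, h, fun a b hab ha hb => ?_, fun y => ?_⟩
  · rcases hT.dist_eq_dist_add_one_of_adj x hab with hd | hd
    · exact (hstep b a hab.symm hb ha hd).symm
    · exact hstep a b hab ha hb hd
  · by_cases hne : ∃ i ∈ s, z i ≠ x ∧ h (z i) = y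
    · obtain ⟨j, -, hj, hjy⟩ := hne
      have hxy : T.Adj x y := hjy ▸ (hh _ hj).1
      have hpt : ∀ i ∈ s, T.dist (z i) y + 2 * (if z i ≠ x ∧ h (z i) = y then 1 else 0) ≤
          T.dist (z i) x + 1 := by
        intro i _
        split_ifs with hi
        · have := (hh _ hi.1).2
          rw [hi.2] at this
          omega
        · have h1 := hT.connected.dist_triangle (u := z i) (v := x) (w := y)
          have h2 := dist_eq_one_iff_adj.2 hxy
          omega
      have hsum := sum_le_sum hpt
      rw [sum_add_distrib, ← mul_sum, ← card_filter, sum_add_distrib, sum_const, smul_eq_mul,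
        mul_one] at hsum
      have := hx y
      simp only [f] at this
      omega
    · have : ({i ∈ s | z i ≠ x ∧ h (z i) = y} : Finset ι) = ∅ := by
        rw [filter_eq_empty_iff]
        exact fun i hi hc => hne ⟨i, hi, hc⟩
      simp [this]

theorem eq_of_induce_connected {N β : Type*} {T : SimpleGraph N} {S : Set N}
    (hS : (T.induce S).Connected) (h : N → β)
    (hh : ∀ a b, T.Adj a b → a ∈ S → b ∈ S → h a = h b) {a b : N} (ha : a ∈ S) (hb : b ∈ S) :
    h a = h b := by
  obtain ⟨p⟩ := hS.preconnected ⟨a, ha⟩ ⟨b, hb⟩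
  suffices H : ∀ u v : S, (T.induce S).Walk u v → h u = h v from H _ _ p
  intro u v q
  induction q with
  | nil => rfl
  | cons e _ ih => exact (hh _ _ e (Subtype.coe_prop _) (Subtype.coe_prop _)).trans ih

open Finset Classical in
/-- Some bag of a tree-decomposition is a balanced separator for any given set `s` of vertices:
the other vertices can be coloured so that adjacent vertices have the same colour and each colour
occurs on at most half of `s`. -/
theorem TreeDecomposition.exists_balanced_bag {V : Type*} {G : SimpleGraph V}
    (D : G.TreeDecomposition) (s : Finset V) :
    ∃ (x : D.Node) (c : V → D.Node),
      (∀ u v, G.Adj u v → u ∉ D.bag x → v ∉ D.bag x → c u = c v) ∧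
      ∀ y, 2 * #{v ∈ s | v ∉ D.bag x ∧ c v = y} ≤ #s := by
  have hz : ∀ v, ∃ z, v ∈ D.bag z := fun v =>
    let ⟨z⟩ := (D.connected v).nonempty
    ⟨z.1, z.2⟩
  choose z hz using hz
  obtain ⟨x, h, hh, hc⟩ := D.isTree.exists_median s z
  -- The nodes whose bags contain `v` form a connected set avoiding `x`, so they lie in one
  -- component.
  have key : ∀ v a, v ∉ D.bag x → v ∈ D.bag a → h (z v) = h a := fun v a hv ha =>
    eq_of_induce_connected (D.connected v) h
      (fun a b hab ha hb => hh a b hab (fun e => hv (e ▸ ha)) (fun e => hv (e ▸ hb))) (hz v) ha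
  refine ⟨x, fun v => h (z v), fun u v huv hu hv => ?_, fun y => ?_⟩
  · obtain ⟨a, hua, hva⟩ := D.edge_mem_bag u v huv
    exact (key u a hu hua).trans (key v a hv hva).symm
  · refine (Nat.mul_le_mul_left 2 (card_le_card ?_)).trans (hc y)
    intro v hv
    rw [mem_filter] at hv ⊢
    exact ⟨hv.1, fun e => hv.2.1 (e ▸ hz v), hv.2.2⟩

end SimpleGraph

/-! ### Cubic graphs of linear treewidth -/

namespace SimpleGraph

/-- Two copies of `ι` disjoint cycles of length `32`, joined by the perfect matching `σ`. -/
def matchedCycles {ι : Type*} (σ : Equiv.Perm (ι × ZMod 32)) :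
    SimpleGraph (Bool × ι × ZMod 32) where
  Adj u v := (u.1 = v.1 ∧ u.2.1 = v.2.1 ∧ (v.2.2 = u.2.2 + 1 ∨ u.2.2 = v.2.2 + 1)) ∨
    (u.1 = false ∧ v.1 = true ∧ σ u.2 = v.2) ∨ (v.1 = false ∧ u.1 = true ∧ σ v.2 = u.2)
  symm := ⟨by
    rintro u v (⟨h1, h2, h3⟩ | h | h)
    · exact Or.inl ⟨h1.symm, h2.symm, h3.symm⟩
    · exact Or.inr (Or.inr h)
    · exact Or.inr (Or.inl h)⟩
  loopless := ⟨by
    rintro u (⟨-, -, h⟩ | ⟨h, h', -⟩ | ⟨h, h', -⟩)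
    · have h0 : (1 : ZMod 32) = 0 := by
        rcases h with h | h <;> exact (left_eq_add.1 h)
      exact absurd h0 (by decide)
    · simp [h] at h'
    · simp [h] at h'⟩

theorem matchedCycles_neighborSet_ncard {ι : Type*} (σ : Equiv.Perm (ι × ZMod 32))
    (u : Bool × ι × ZMod 32) : ((matchedCycles σ).neighborSet u).ncard = 3 := by
  have h2 : (1 : ZMod 32) ≠ -1 := by decide
  obtain ⟨b, i, j⟩ := u
  have hj : ∀ k : ZMod 32, j = k + 1 ↔ k = j - 1 := fun k =>
    ⟨fun h => by rw [h, add_sub_cancel_right], fun h => by rw [h, sub_add_cancel]⟩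
  have h3 : j + 1 ≠ j - 1 := fun h => h2 (by rw [sub_eq_add_neg] at h; exact add_left_cancel h)
  cases b
  · have : (matchedCycles σ).neighborSet (false, i, j) =
        {(false, i, j + 1), (false, i, j - 1), (true, σ (i, j))} := by
      ext ⟨b, i', j'⟩
      cases b <;> simp [matchedCycles, mem_neighborSet, hj, eq_comm (a := i)]
      all_goals grind
    rw [this, Set.ncard_eq_three]
    exact ⟨_, _, _, by simpa using h3, by simp, by simp, rfl⟩
  · have : (matchedCycles σ).neighborSet (true, i, j) =
        {(true, i, j + 1), (true, i, j - 1), (false, σ.symm (i, j))} := by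
      ext ⟨b, i', j'⟩
      cases b <;>
        simp [matchedCycles, mem_neighborSet, hj, eq_comm (a := i), ← Equiv.eq_symm_apply]
      all_goals grind
    rw [this, Set.ncard_eq_three]
    exact ⟨_, _, _, by simpa using h3, by simp, by simp, rfl⟩

-- Suppose that all bags have at most `t` vertices, and take a bag balanced for a set with one
-- vertex from each left cycle. On each side at least `9 * t` cycles miss the bag, and each of these
-- is monochromatic. Some set `P` of colours covers between `2 * t` and `7 * t` of those on the
-- left, so at least `2 * t` lie outside. On the right, `P` or its complement also covers at least
-- `2 * t`. Mixing then gives a matching edge between a cycle coloured in `P` and one that is not,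
-- yet its ends avoid the bag and must share a colour.
open Finset Classical in
theorem le_treewidth_matchedCycles {t : ℕ}
    {σ : Equiv.Perm (Fin (10 * t) × ZMod 32)}
    (hσ : ∀ A B : Finset (Fin (10 * t)), 2 * t ≤ #A → 2 * t ≤ #B → ∃ p, p.1 ∈ A ∧ (σ p).1 ∈ B) :
    (t : ℕ∞) ≤ (matchedCycles σ).treewidth := by
  refine le_iInf fun D => ?_
  suffices H : ∃ x, ((t + 1 : ℕ) : ℕ∞) ≤ (D.bag x).encard by
    obtain ⟨x, hx⟩ := H
    have h1 : ((t + 1 : ℕ) : ℕ∞) ≤ ⨆ x, (D.bag x).encard := hx.trans (le_iSup (fun x => (D.bag x).encard) x)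
    have h2 : ((t + 1 : ℕ) : ℕ∞) - 1 ≤ D.width := tsub_le_tsub_right h1 1
    simpa using h2
  by_contra! hbag
  have hcard : ∀ x, (D.bag x).toFinset.card ≤ t := by
    intro x
    have := hbag x
    rw [Set.encard_eq_coe_toFinset_card, Nat.cast_lt] at this
    omega
  obtain ⟨x, c, hc, hbal⟩ := D.exists_balanced_bag
    ((univ : Finset (Fin (10 * t))).image fun i => (false, i, (0 : ZMod 32)))
  have hcs : #((univ : Finset (Fin (10 * t))).image fun i => (false, i, (0 : ZMod 32))) ≤
      10 * t := card_image_le.trans (by simp)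
  let good : Bool → Finset (Fin (10 * t)) := fun b => {i | ∀ j, (b, i, j) ∉ D.bag x}
  have hgood : ∀ b, 9 * t ≤ #(good b) := by
    intro b
    have h1 : #(good b)ᶜ ≤ t := by
      refine le_trans ?_ (hcard x)
      refine le_trans (card_le_card ?_) (card_image_le (f := fun v => v.2.1))
      intro i hi
      simp only [good, mem_compl, mem_filter, mem_univ, true_and, not_forall, not_not] at hi
      obtain ⟨j, hj⟩ := hi
      exact mem_image.2 ⟨_, Set.mem_toFinset.2 hj, rfl⟩
    rw [card_compl, Fintype.card_fin] at h1
    omega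
  have hconst : ∀ b, ∀ i ∈ good b, ∀ j, c (b, i, j) = c (b, i, 0) := by
    intro b i hi j
    simp only [good, mem_filter, mem_univ, true_and] at hi
    have hn : ∀ n : ℕ, c (b, i, (n : ZMod 32)) = c (b, i, 0) := by
      intro n
      induction n with
      | zero => simp
      | succ n ih =>
        rw [← ih]
        refine (hc (b, i, (n : ZMod 32)) (b, i, ((n + 1 : ℕ) : ZMod 32)) ?_ (hi _) (hi _)).symm
        exact Or.inl ⟨rfl, rfl, Or.inl (Nat.cast_succ n)⟩
    simpa using hn j.val
  obtain ⟨P, hP1, hP2⟩ := Finset.exists_colors_card_between (good false)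
    (fun i => c (false, i, 0)) (5 * t) (2 * t) (by
      intro y
      have h1 := (hbal y).trans hcs
      have h2 : #{i ∈ good false | c (false, i, 0) = y} ≤
          #{v ∈ (univ : Finset (Fin (10 * t))).image fun i => (false, i, (0 : ZMod 32)) |
            v ∉ D.bag x ∧ c v = y} := by
        refine card_le_card_of_injOn (fun i => (false, i, 0)) ?_ ?_
        · intro i hi
          simp only [good, coe_filter, mem_filter, mem_univ, true_and, Set.mem_ofPred_eq] at hi
          simpa using ⟨hi.1 0, hi.2⟩
        · intro i _ i' _ h
          simpa using h
      omega) (by have := hgood false; omega)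
  have hL := card_filter_add_card_filter_not (s := good false) (fun i => c (false, i, 0) ∈ P)
  have hR := card_filter_add_card_filter_not (s := good true) (fun i => c (true, i, 0) ∈ P)
  have hgL := hgood false
  have hgR := hgood true
  have hedge : ∀ p : Fin (10 * t) × ZMod 32, p.1 ∈ good false → (σ p).1 ∈ good true →
      c (false, p.1, 0) = c (true, (σ p).1, 0) := by
    intro p hp hq
    rw [← hconst _ _ hp p.2, ← hconst _ _ hq (σ p).2]
    simp only [good, mem_filter, mem_univ, true_and] at hp hq
    exact hc _ _ (Or.inr (Or.inl ⟨rfl, rfl, rfl⟩)) (hp _) (hq _)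
  by_cases hB : 2 * t ≤ #{i ∈ good true | c (true, i, 0) ∈ P}
  · obtain ⟨p, hp, hq⟩ := hσ {i ∈ good false | c (false, i, 0) ∉ P} _ (by omega) hB
    rw [mem_filter] at hp hq
    exact hp.2 (hedge p hp.1 hq.1 ▸ hq.2)
  · obtain ⟨p, hp, hq⟩ := hσ _ {i ∈ good true | c (true, i, 0) ∉ P} hP1 (by omega)
    rw [mem_filter] at hp hq
    exact hq.2 (hedge p hp.1 hq.1 ▸ hp.2)

/-- Tree-decompositions can be transported along isomorphisms. -/
def TreeDecomposition.map {V W : Type*} {G : SimpleGraph V} {H : SimpleGraph W} (e : G ≃g H)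
    (D : G.TreeDecomposition) : H.TreeDecomposition where
  Node := D.Node
  tree := D.tree
  isTree := D.isTree
  bag x := e.symm ⁻¹' D.bag x
  edge_mem_bag _ _ huv := D.edge_mem_bag _ _ (e.symm.map_adj_iff.2 huv)
  connected v := D.connected (e.symm v)

theorem Iso.treewidth_le {V W : Type*} {G : SimpleGraph V} {H : SimpleGraph W} (e : G ≃g H) :
    H.treewidth ≤ G.treewidth := by
  refine le_iInf fun D => (iInf_le _ (D.map e)).trans ?_
  refine tsub_le_tsub_right (iSup_mono fun x => ?_) 1
  exact (Set.encard_preimage_of_bijective e.symm.bijective _).le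

/-- There are cubic graphs on `640 t` vertices with treewidth at least `t`. -/
theorem exists_cubic_le_treewidth (t : ℕ) (ht : 0 < t) :
    ∃ G : SimpleGraph (Fin (640 * t)), (∀ v, (G.neighborSet v).ncard = 3) ∧
      (t : ℕ∞) ≤ G.treewidth := by
  obtain ⟨σ, hσ⟩ := Equiv.Perm.exists_mixing t ht
  have hcard : Fintype.card (Bool × Fin (10 * t) × ZMod 32) = 640 * t := by
    simp [ZMod.card]
    ring
  let e := Fintype.equivFinOfCardEq hcard
  let f : (matchedCycles σ).comap e.symm ≃g matchedCycles σ := Iso.comap e.symm _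
  refine ⟨(matchedCycles σ).comap e.symm, fun v => ?_,
    (le_treewidth_matchedCycles hσ).trans f.treewidth_le⟩
  rw [← matchedCycles_neighborSet_ncard σ (f v), ← Nat.card_coe_set_eq, ← Nat.card_coe_set_eq]
  exact Nat.card_congr (f.mapNeighborSet v)

end SimpleGraph

/-! ### Bounds on growth -/

namespace SimpleGraph

theorem encard_edist_le {V : Type*} {G : SimpleGraph V} {d : ℕ}
    (hd : ∀ v, (G.neighborSet v).encard ≤ d) (u : V) (r : ℕ) :
    {v | G.edist u v ≤ r}.encard ≤ ((d + 1) ^ r : ℕ) := by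
  classical
  induction r generalizing u with
  | zero =>
    refine (Set.encard_le_one_iff.2 fun a b ha hb => ?_).trans (by simp)
    simp only [Nat.cast_zero, nonpos_iff_eq_zero, edist_eq_zero_iff, Set.mem_ofPred_eq] at ha hb
    exact ha.symm.trans hb
  | succ r ih =>
    have hfin : ∀ v, {w | G.edist v w ≤ r}.Finite := fun v => Set.finite_of_encard_le_coe (ih v)
    have hN : (G.neighborSet u).Finite := Set.finite_of_encard_le_coe (hd u)
    have hNd : hN.toFinset.card ≤ d := by
      have := hd u
      rwa [hN.encard_eq_coe_toFinset_card, Nat.cast_le] at this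
    have hcard : ((insert u hN.toFinset).biUnion fun v => (hfin v).toFinset).card ≤
        (d + 1) ^ (r + 1) := by
      rw [pow_succ']
      refine (Finset.card_biUnion_le_card_mul _ _ ((d + 1) ^ r) fun v _ => ?_).trans ?_
      · have := ih v
        rwa [(hfin v).encard_eq_coe_toFinset_card, Nat.cast_le] at this
      · exact Nat.mul_le_mul_right _ ((Finset.card_insert_le _ _).trans (by omega))
    refine le_trans (Set.encard_le_encard fun v hv => ?_)
      ((Set.encard_coe_eq_coe_finsetCard _).trans_le (Nat.cast_le.2 hcard))
    have hv' : G.edist u v ≤ (r + 1 : ℕ) := hv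
    obtain ⟨p, hp⟩ :=
      exists_walk_of_edist_ne_top (ne_top_of_le_ne_top (ENat.natCast_ne_top (r + 1)) hv')
    rw [← hp, Nat.cast_le] at hv'
    simp only [Finset.coe_biUnion, Set.mem_iUnion, Finset.mem_coe, Finset.mem_insert,
      Set.Finite.mem_toFinset, Set.mem_ofPred_eq, mem_neighborSet]
    cases p with
    | nil => exact ⟨u, Or.inl rfl, by simp⟩
    | @cons _ w _ h q =>
      rw [Walk.length_cons, Nat.add_le_add_iff_right] at hv'
      exact ⟨w, Or.inr h, (edist_le q).trans (Nat.cast_le.2 hv')⟩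

/-- A subgraph of radius at most `r` lies in the ball of `G` around its own centre, as its walks are
walks of `G`. -/
theorem growth_le_encard {V : Type*} {G : SimpleGraph V} {r : ℕ} {b : ℕ∞}
    (hb : ∀ u, {v | G.edist u v ≤ r}.encard ≤ b) : G.growth r ≤ b := by
  refine iSup₂_le fun H hH => ?_
  rcases isEmpty_or_nonempty H.verts with he | he
  · simp [Set.isEmpty_coe_sort.1 he]
  obtain ⟨u, hu⟩ := H.coe.exists_eccent_eq_radius
  rw [← hu, eccent_le_iff] at hH
  refine le_trans (Set.encard_le_encard fun v hv => ?_) (hb u)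
  have h1 := hH ⟨v, hv⟩
  have hne : H.coe.edist u ⟨v, hv⟩ ≠ ⊤ := ne_top_of_le_ne_top (ENat.natCast_ne_top r) h1
  obtain ⟨p, hp⟩ := exists_walk_of_edist_ne_top hne
  rw [← hp] at h1
  have h2 := edist_le (p.map H.hom)
  rw [Walk.length_map] at h2
  exact h2.trans h1

theorem growth_le_card {V : Type*} [Fintype V] (G : SimpleGraph V) (r : ℕ) :
    G.growth r ≤ Fintype.card V :=
  growth_le_encard fun _ => (Set.encard_le_encard (Set.subset_univ _)).trans (by simp)

end SimpleGraph

/-! ### Numerical estimates and conclusion -/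

/-- If `log k ≤ 4 * r`, the second term suffices. Otherwise `4 ^ r ≤ √k`, and `log k ≤ 2 * √k`. -/
theorem min_four_pow_le (k r : ℕ) (hk : 2 ≤ k) (hr : 1 ≤ r) :
    min ((4 : ℝ) ^ r) (640 * k) ≤ 2560 * k * r / Real.log k := by
  have hk' : (2 : ℝ) ≤ k := by exact_mod_cast hk
  have hr' : (1 : ℝ) ≤ r := by exact_mod_cast hr
  have hlog : 0 < Real.log k := Real.log_pos (by linarith)
  rw [le_div_iff₀ hlog]
  by_cases h : Real.log k ≤ 4 * r
  · calc _ ≤ (640 * k) * Real.log k := by gcongr; exact min_le_right _ _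
      _ ≤ (640 * k) * (4 * r) := by gcongr
      _ = _ := by ring
  · push Not at h
    have hs : 0 < √(k : ℝ) := Real.sqrt_pos.2 (by linarith)
    have h1 : (4 : ℝ) ^ r ≤ √k := by
      have h4 : Real.log 4 ≤ 2 := by
        have : Real.log 4 = 2 * Real.log 2 := by
          rw [show (4 : ℝ) = 2 ^ 2 by norm_num, Real.log_pow]; norm_num
        have := Real.log_two_lt_d9
        linarith
      rw [← Real.log_le_log_iff (by positivity) hs, Real.log_pow, Real.log_sqrt (by linarith)]
      nlinarith
    have h2 : Real.log k ≤ 2 * √k := by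
      have := Real.log_le_sub_one_of_pos hs
      rw [Real.log_sqrt (by linarith)] at this
      linarith
    have h3 : √(k : ℝ) * √k = k := Real.mul_self_sqrt (by linarith)
    calc _ ≤ √(k : ℝ) * (2 * √k) := by
            gcongr
            exact (min_le_left _ _).trans h1
      _ = 2 * k := by linear_combination 2 * h3
      _ ≤ 2560 * k * r := by nlinarith

theorem ENat.toEReal_natCast (n : ℕ) : (((n : ℕ∞) : ENNReal) : EReal) = ((n : ℝ) : EReal) := by
  exact EReal.coe_nnreal_eq_coe_real n

theorem ENat.toEReal_le_coe {a : ℕ∞} {b : ℝ} {n : ℕ} (ha : a ≤ n) (hn : (n : ℝ) ≤ b) :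
    (a : EReal) ≤ (b : EReal) := by
  refine le_trans ?_ (EReal.coe_le_coe_iff.2 hn)
  rw [← ENat.toEReal_natCast]
  exact EReal.coe_ennreal_le_coe_ennreal_iff.2 (ENat.toENNReal_le.2 ha)

theorem ENat.coe_le_toEReal {a : ℕ∞} {b : ℝ} {n : ℕ} (ha : n ≤ a) (hn : b ≤ n) :
    (b : EReal) ≤ (a : EReal) := by
  refine (EReal.coe_le_coe_iff.2 hn).trans ?_
  rw [← ENat.toEReal_natCast]
  exact EReal.coe_ennreal_le_coe_ennreal_iff.2 (ENat.toENNReal_le.2 ha)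

theorem SimpleGraph.exists_cubic_growth_le (k : ℕ) (hk : 2 ≤ k) :
    ∃ G : SimpleGraph (Fin (640 * k)), (∀ v, (G.neighborSet v).ncard = 3) ∧
      (k : ℕ∞) ≤ G.treewidth ∧ ∀ r : ℕ, 1 ≤ r →
        (G.growth r : EReal) ≤ ((2560 * k * r / Real.log k : ℝ) : EReal) := by
  obtain ⟨G, hG, htw⟩ := exists_cubic_le_treewidth k (by omega)
  refine ⟨G, hG, htw, fun r hr => ?_⟩
  have hd : ∀ v, (G.neighborSet v).encard ≤ (3 : ℕ) := fun v => by
    rw [← hG v, (Set.toFinite _).cast_ncard_eq]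
  have h1 : G.growth r ≤ ((4 ^ r : ℕ) : ℕ∞) := growth_le_encard fun u => encard_edist_le hd u r
  have h2 : G.growth r ≤ ((640 * k : ℕ) : ℕ∞) := by simpa using G.growth_le_card r
  have h3 := min_four_pow_le k r hk hr
  rcases min_le_iff.1 h3 with h | h
  · exact ENat.toEReal_le_coe h1 (by exact_mod_cast h)
  · exact ENat.toEReal_le_coe h2 (by exact_mod_cast h)

/-- The witness is `c * log c / 10240` rounded up. Here 10240 is 2560 · 2 · 2: one factor 2 absorbs
the rounding, the other the loss in `log k ≥ log c / 2`. The lower bound on `c` ensures `k ≥ √c`,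
whence that estimate. -/
theorem Real.exists_nat_div_log_le (c : ℝ) (hc : 10240 ^ 2 ≤ c) :
    ∃ k : ℕ, 2 ≤ k ∧ 1 / 10240 * (c * Real.log c) ≤ k ∧ 2560 * k / Real.log k ≤ c := by
  have hc0 : 0 < c := by linarith
  have hs : 10240 ≤ √c := Real.le_sqrt_of_sq_le hc
  have hss : √c * √c = c := Real.mul_self_sqrt hc0.le
  have hlog : 1 ≤ Real.log c := by
    rw [Real.le_log_iff_exp_le hc0]
    have := Real.exp_one_lt_d9
    linarith
  set x := 1 / 10240 * (c * Real.log c) with hx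
  have hxs : √c ≤ x := by
    have h1 : √c * 10240 ≤ √c * √c := by gcongr
    have h2 : c * 1 ≤ c * Real.log c := by gcongr
    linarith
  have hk1 : x ≤ ⌈x⌉₊ := Nat.le_ceil x
  have hk2 : (⌈x⌉₊ : ℝ) < x + 1 := Nat.ceil_lt_add_one (by linarith)
  have hlogk : Real.log c / 2 ≤ Real.log ⌈x⌉₊ := by
    rw [← Real.log_sqrt hc0.le]
    exact Real.log_le_log (by linarith) (by linarith)
  refine ⟨⌈x⌉₊, ?_, hk1, ?_⟩
  · have : (2 : ℝ) ≤ ⌈x⌉₊ := by linarith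
    exact_mod_cast this
  · rw [div_le_iff₀ (by linarith)]
    calc 2560 * (⌈x⌉₊ : ℝ) ≤ 2560 * (2 * x) := by linarith
      _ = c * (Real.log c / 2) := by rw [hx]; ring
      _ ≤ _ := by gcongr

theorem mainTheorem3 :
    -- every function bounding the treewidth in terms of linear growth is `Ω(c log c)`
    (∀ g : ℝ → ℝ,
      (∀ c : ℝ, 1 ≤ c → ∀ (V : Type) [Finite V] [Nonempty V] (G : SimpleGraph V),
        (∀ r : ℕ, 1 ≤ r → (G.growth r : EReal) ≤ ((c * r : ℝ) : EReal)) →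
          (G.treewidth : EReal) ≤ (g c : EReal)) →
      ∃ δ : ℝ, 0 < δ ∧ ∃ c₀ : ℝ, ∀ c : ℝ, c₀ ≤ c → δ * (c * Real.log c) ≤ g c) ∧
    -- the witnesses: cubic graphs with linear treewidth and growth at most `β k r / log k`
    (∃ α β : ℝ, 0 < α ∧ 0 < β ∧ ∀ k : ℕ, 2 ≤ k →
      ∃ (n : ℕ) (G : SimpleGraph (Fin n)) (_ : G.LocallyFinite),
        G.IsRegularOfDegree 3 ∧
        (k : ℕ∞) ≤ G.treewidth ∧
        ((α * n : ℝ) : EReal) ≤ (G.treewidth : EReal) ∧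
        ∀ r : ℕ, 1 ≤ r →
          (G.growth r : EReal) ≤ ((β * k * r / Real.log k : ℝ) : EReal)) := by
  refine ⟨fun g hg => ⟨1 / 10240, by norm_num, 10240 ^ 2, fun c hc => ?_⟩,
    1 / 640, 2560, by norm_num, by norm_num, fun k hk => ?_⟩
  · obtain ⟨k, hk, hck, hkc⟩ := Real.exists_nat_div_log_le c hc
    obtain ⟨G, -, htw, hgr⟩ := SimpleGraph.exists_cubic_growth_le k hk
    have : NeZero (640 * k) := ⟨by omega⟩
    have h := hg c (by linarith) (Fin (640 * k)) G fun r hr =>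
      (hgr r hr).trans (EReal.coe_le_coe_iff.2 (by
        rw [mul_div_right_comm]
        gcongr))
    exact EReal.coe_le_coe_iff.1 ((ENat.coe_le_toEReal htw hck).trans h)
  · obtain ⟨G, hG, htw, hgr⟩ := SimpleGraph.exists_cubic_growth_le k hk
    let : G.LocallyFinite := fun _ => Fintype.ofFinite _
    refine ⟨640 * k, G, this, fun v => ?_, htw,
      ENat.coe_le_toEReal htw (le_of_eq (by push_cast; ring)), hgr⟩
    rw [← SimpleGraph.card_neighborSet_eq_degree, ← hG v, ← Nat.card_eq_fintype_card,
      Nat.card_coe_set_eq]
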